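/- Let $\mathcal L_{\mathbb N}$ be the first-order language of arithmetic with equality, with signature $\{0,\mathrm S,+,\times\}$ and logical constants $\neg,\wedge,\forall$, and let $\mathcal L_T=\mathcal L_{\mathbb N}\cup\{T\}$ with $T$ a unary predicate symbol. Formulas that differ only in the names of bound variables are identified. Fix a Gödel numbering $\varphi\mapsto\#\varphi\in\mathbb N$ that is injective on the sentences of $\mathcal L_T$, and write $\overline n$ for the numeral of $n$. Sequents $\Gamma\Rightarrow\Delta$ consist of finite multisets of formulas. The calculus $\mathrm Q^g$ has the initial sequents $\Gamma,s=t\Rightarrow s=t,\Delta$ and $\Gamma,\mathrm S x=0\Rightarrow\Delta$ and the following rules (premises / conclusion), where $s,t$ are terms and $x,y$ are variables: - cut: $\Gamma\Rightarrow\Delta,\varphi$ and $\varphi,\Gamma\Rightarrow\Delta$ / $\Gamma\Rightarrow\Delta$; - $\neg$: $\Gamma\Rightarrow\varphi,\Delta$ / $\Gamma,\neg\varphi\Rightarrow\Delta$; and $\Gamma,\varphi\Rightarrow\Delta$ / $\Gamma\Rightarrow\neg\varphi,\Delta$; - $\wedge$: $\Gamma,\varphi,\psi\Rightarrow\Delta$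 / $\Gamma,\varphi\wedge\psi\Rightarrow\Delta$; and $\Gamma\Rightarrow\varphi,\Delta$ and $\Gamma\Rightarrow\psi,\Delta$ / $\Gamma\Rightarrow\varphi\wedge\psi,\Delta$; - $\forall$: $\Gamma,\forall x\varphi,\varphi(s/x)\Rightarrow\Delta$ / $\Gamma,\forall x\varphi\Rightarrow\Delta$; and $\Gamma\Rightarrow\varphi(y/x),\Delta$ / $\Gamma\Rightarrow\forall x\varphi,\Delta$, with $y$ not free in $\Gamma,\Delta,\forall x\varphi$; - identity: $\Gamma,t=t\Rightarrow\Delta$ / $\Gamma\Rightarrow\Delta$; and $s=t,\varphi(s),\varphi(t),\Gamma\Rightarrow\Delta$ / $s=t,\varphi(t),\Gamma\Rightarrow\Delta$, with $\varphi(v)$ an atomic formula of $\mathcal L_{\mathbb N}$; - $\Gamma,x=y,\mathrm S x=\mathrm S y\Rightarrow\Delta$ / $\Gamma,\mathrm S x=\mathrm S y\Rightarrow\Delta$; - $\Gamma,x=0\Rightarrow\Delta$ and $\Gamma,x=\mathrm S y\Rightarrow\Delta$ / $\Gamma\Rightarrow\Delta$, with $y$ distinct from $x$ and not free in $\Gamma,\Delta$;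 - $\Gamma,\varepsilon\Rightarrow\Delta$ / $\Gamma\Rightarrow\Delta$, where $\varepsilon$ is one of $x+0=x$, $\;x+\mathrm S y=\mathrm S(x+y)$, $\;x\times 0=0$, $\;x\times\mathrm S y=(x\times y)+x$. The calculus $\mathrm{LPT}_{\mathbb N}$ is $\mathrm Q^g$ formulated in $\mathcal L_T$ together with the truth rules $\Gamma,\varphi\Rightarrow\Delta$ / $\Gamma,T\overline{\#\varphi}\Rightarrow\Delta$ and $\Gamma\Rightarrow\varphi,\Delta$ / $\Gamma\Rightarrow T\overline{\#\varphi},\Delta$, for every sentence $\varphi$ of $\mathcal L_T$. Then $\mathrm{LPT}_{\mathbb N}$ is a conservative extension of $\mathrm Q^g$: every sequent of $\mathcal L_T$ derivable in $\mathrm Q^g$ is derivable in $\mathrm{LPT}_{\mathbb N}$, and for every sequent $\Gamma\Rightarrow\Delta$ of $\mathcal L_{\mathbb N}$ the following are equivalent: it is derivable in $\mathrm{LPT}_{\mathbb N}$; it is derivable in $\mathrm Q^g$ formulated in $\mathcal L_T$ (without truth rules); it is derivable in $\mathrm Q^g$ formulated in $\mathcal L_{\mathbb N}$, that is, by a derivation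 in which only formulas of $\mathcal L_{\mathbb N}$ occur. -/

import Mathlib

/-- Terms over the signature `0, S, +, ×`. Free variables are named by natural numbers,
`n` is the number of bound variables in scope (de Bruijn indices, `0` the innermost binder),
so formulas that differ only in the names of bound variables are identified. -/
inductive Tm : ℕ → Type
  | fvar {n : ℕ} (x : ℕ) : Tm n
  | bvar {n : ℕ} (i : Fin n) : Tm n
  | zero {n : ℕ} : Tm n
  | succ {n : ℕ} (t : Tm n) : Tm n
  | add {n : ℕ} (s t : Tm n) : Tm n
  | mul {n : ℕ} (s t : Tm n) : Tm n

namespace Tm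

/-- Simultaneous substitution of terms for the bound variables in scope. -/
def subst {n m : ℕ} (σ : Fin n → Tm m) : Tm n → Tm m
  | fvar x => fvar x
  | bvar i => σ i
  | zero => zero
  | succ t => succ (t.subst σ)
  | add s t => add (s.subst σ) (t.subst σ)
  | mul s t => mul (s.subst σ) (t.subst σ)

/-- Weakening of the scope by one more (innermost) bound variable. -/
def shift {n : ℕ} (t : Tm n) : Tm (n + 1) := t.subst fun i => bvar i.succ

/-- The (free) variables of a term. -/
def fv {n : ℕ} : Tm n → Finset ℕ
  | fvar x => {x}
  | bvar _ => ∅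
  | zero => ∅
  | succ t => t.fv
  | add s t => s.fv ∪ t.fv
  | mul s t => s.fv ∪ t.fv

/-- `t(s)`, for a term `t(v)` with one place `v`. -/
def inst (t : Tm 1) (s : Tm 0) : Tm 0 := t.subst fun _ => s

/-- The numeral of `k`. -/
def numeral : ℕ → Tm 0
  | 0 => zero
  | k + 1 => succ (numeral k)

end Tm

/-- First-order formulas with primitive `¬, ∧, ∀` in the language of arithmetic with equality,
expanded by one unary predicate symbol for each element of `U`. `Fml U 0` is the type of formulas
proper; `Fml U n` has `n` bound variables in scope. -/
inductive Fml (U : Type) : ℕ → Type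
  | eq {n : ℕ} (s t : Tm n) : Fml U n
  | pred {n : ℕ} (u : U) (t : Tm n) : Fml U n
  | neg {n : ℕ} (φ : Fml U n) : Fml U n
  | and {n : ℕ} (φ ψ : Fml U n) : Fml U n
  | all {n : ℕ} (φ : Fml U (n + 1)) : Fml U n

namespace Fml

variable {U : Type}

/-- Simultaneous substitution of terms for the bound variables in scope. -/
def subst : {n m : ℕ} → (Fin n → Tm m) → Fml U n → Fml U m
  | _, _, σ, eq s t => eq (s.subst σ) (t.subst σ)
  | _, _, σ, pred u t => pred u (t.subst σ)
  | _, _, σ, neg φ => neg (subst σ φ)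
  | _, _, σ, and φ ψ => and (subst σ φ) (subst σ ψ)
  | _, _, σ, all φ => all (subst (Fin.cases (Tm.bvar 0) fun i => (σ i).shift) φ)

/-- `φ(s/x)`, where `φ` is the matrix of `∀ x φ`. -/
def inst (φ : Fml U 1) (s : Tm 0) : Fml U 0 := φ.subst fun _ => s

/-- The free variables of a formula. -/
def fv : {n : ℕ} → Fml U n → Finset ℕ
  | _, eq s t => s.fv ∪ t.fv
  | _, pred _ t => t.fv
  | _, neg φ => fv φ
  | _, and φ ψ => fv φ ∪ fv ψ
  | _, all φ => fv φ

/-- A sentence is a formula without free variables. -/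
def IsSentence (φ : Fml U 0) : Prop := φ.fv = ∅

end Fml

/-- Formulas of the language `L_ℕ` of arithmetic. -/
abbrev ArithFml : ℕ → Type := Fml Empty

/-- Formulas of `L_ℕ ∪ {T}`. -/
abbrev TruthFml : ℕ → Type := Fml Unit

/-- The atomic formula `T t`. -/
abbrev TruthFml.T {n : ℕ} (t : Tm n) : TruthFml n := Fml.pred () t

/-- The inclusion of `L_ℕ` in `L_ℕ ∪ {T}`. -/
def ArithFml.toTruth : {n : ℕ} → ArithFml n → TruthFml n
  | _, .eq s t => .eq s t
  | _, .pred u _ => u.elim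
  | _, .neg φ => .neg (ArithFml.toTruth φ)
  | _, .and φ ψ => .and (ArithFml.toTruth φ) (ArithFml.toTruth ψ)
  | _, .all φ => .all (ArithFml.toTruth φ)

/-- `x` is not free in any formula of `Γ`. -/
def NotFreeIn {U : Type} (x : ℕ) (Γ : Multiset (Fml U 0)) : Prop := ∀ φ ∈ Γ, x ∉ φ.fv

open Fml Tm in
/-- Derivability of the sequent `Γ ⇒ Δ` (`Γ`, `Δ` finite multisets) in the G3-style calculus with
cut, initial sequents for equations only, the rules for identity, the geometric rules of Robinson
arithmetic, and the left and right rules that pass from `φ` to `ψ` for every pair with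
`Names φ ψ`, to be read as: `ψ` is the truth ascription to `φ`. -/
inductive Derivable {U : Type} (Names : Fml U 0 → Fml U 0 → Prop) :
    Multiset (Fml U 0) → Multiset (Fml U 0) → Prop
  | ref {Γ Δ} (s t : Tm 0) : Derivable Names (eq s t ::ₘ Γ) (eq s t ::ₘ Δ)
  | cut {Γ Δ} (φ : Fml U 0) : Derivable Names Γ (φ ::ₘ Δ) → Derivable Names (φ ::ₘ Γ) Δ →
      Derivable Names Γ Δ
  | negL {Γ Δ} (φ : Fml U 0) : Derivable Names Γ (φ ::ₘ Δ) → Derivable Names (neg φ ::ₘ Γ) Δ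
  | negR {Γ Δ} (φ : Fml U 0) : Derivable Names (φ ::ₘ Γ) Δ → Derivable Names Γ (neg φ ::ₘ Δ)
  | andL {Γ Δ} (φ ψ : Fml U 0) : Derivable Names (φ ::ₘ ψ ::ₘ Γ) Δ →
      Derivable Names (and φ ψ ::ₘ Γ) Δ
  | andR {Γ Δ} (φ ψ : Fml U 0) : Derivable Names Γ (φ ::ₘ Δ) → Derivable Names Γ (ψ ::ₘ Δ) →
      Derivable Names Γ (and φ ψ ::ₘ Δ)
  | allL {Γ Δ} (φ : Fml U 1) (s : Tm 0) : Derivable Names (all φ ::ₘ φ.inst s ::ₘ Γ) Δ →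
      Derivable Names (all φ ::ₘ Γ) Δ
  | allR {Γ Δ} (φ : Fml U 1) (y : ℕ) : NotFreeIn y Γ → NotFreeIn y Δ → y ∉ (all φ).fv →
      Derivable Names Γ (φ.inst (fvar y) ::ₘ Δ) → Derivable Names Γ (all φ ::ₘ Δ)
  | eq1 {Γ Δ} (t : Tm 0) : Derivable Names (eq t t ::ₘ Γ) Δ → Derivable Names Γ Δ
  /-- Replacement in the atomic formula `a(v) = b(v)` of the language of arithmetic. -/
  | eq2 {Γ Δ} (s t : Tm 0) (a b : Tm 1) :
      Derivable Names
        (eq s t ::ₘ eq (a.inst s) (b.inst s) ::ₘ eq (a.inst t) (b.inst t) ::ₘ Γ) Δ →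
      Derivable Names (eq s t ::ₘ eq (a.inst t) (b.inst t) ::ₘ Γ) Δ
  | q1 {Γ Δ} (x : ℕ) : Derivable Names (eq (succ (fvar x)) zero ::ₘ Γ) Δ
  | q2 {Γ Δ} (x y : ℕ) :
      Derivable Names
        (eq (fvar x) (fvar y) ::ₘ eq (succ (fvar x)) (succ (fvar y)) ::ₘ Γ) Δ →
      Derivable Names (eq (succ (fvar x)) (succ (fvar y)) ::ₘ Γ) Δ
  | q3 {Γ Δ} (x y : ℕ) : NotFreeIn y Γ → NotFreeIn y Δ → y ≠ x →
      Derivable Names (eq (fvar x) zero ::ₘ Γ) Δ →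
      Derivable Names (eq (fvar x) (succ (fvar y)) ::ₘ Γ) Δ → Derivable Names Γ Δ
  | q4 {Γ Δ} (x : ℕ) : Derivable Names (eq (add (fvar x) zero) (fvar x) ::ₘ Γ) Δ →
      Derivable Names Γ Δ
  | q5 {Γ Δ} (x y : ℕ) :
      Derivable Names
        (eq (add (fvar x) (succ (fvar y))) (succ (add (fvar x) (fvar y))) ::ₘ Γ) Δ →
      Derivable Names Γ Δ
  | q6 {Γ Δ} (x : ℕ) : Derivable Names (eq (mul (fvar x) zero) zero ::ₘ Γ) Δ →
      Derivable Names Γ Δ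
  | q7 {Γ Δ} (x y : ℕ) :
      Derivable Names
        (eq (mul (fvar x) (succ (fvar y))) (add (mul (fvar x) (fvar y)) (fvar x)) ::ₘ Γ) Δ →
      Derivable Names Γ Δ
  | truthL {Γ Δ} (φ ψ : Fml U 0) : Names φ ψ → Derivable Names (φ ::ₘ Γ) Δ →
      Derivable Names (ψ ::ₘ Γ) Δ
  | truthR {Γ Δ} (φ ψ : Fml U 0) : Names φ ψ → Derivable Names Γ (φ ::ₘ Δ) →
      Derivable Names Γ (ψ ::ₘ Δ)

/-- Derivability in `Q^g`: there are no truth rules. Here `QG` over `ArithFml` uses only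
arithmetical formulas, and `QG` over `TruthFml` is the same calculus in `L_ℕ ∪ {T}`. -/
def QG {U : Type} (Γ Δ : Multiset (Fml U 0)) : Prop := Derivable (fun _ _ => False) Γ Δ

/-- Derivability in `LPT_ℕ`: `Q^g` in the language `L_ℕ ∪ {T}` with the rules that pass, on the
left and on the right, from a sentence `φ` to `T l`, `l` the numeral of the code of `φ`. -/
def LPTN (code : TruthFml 0 → ℕ) (Γ Δ : Multiset (TruthFml 0)) : Prop :=
  Derivable (fun φ ψ => φ.IsSentence ∧ ψ = TruthFml.T (Tm.numeral (code φ))) Γ Δ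

/-! The proof is semantic. Suppose an arithmetical sequent is underivable in `QG`. A Henkin
construction extends it to a set `L` deciding every arithmetical formula, with a witness for each
universal formula outside `L`. Terms form a structure in which `s` equals `t` when `eq s t ∈ L`; by
`IsHenkin.holds_iff_mem` truth there is membership in `L`, and the structure satisfies Robinson
arithmetic.

Over this structure the truth predicate is interpreted by Kripke's least fixed point for strong
Kleene logic. All rules of `LPTN` preserve "some formula on the left is false or some formula on the
right is true" (`Derivable.sequentHolds`). Initial sequents are sound because they concern equations
only, and equality is two-valued; cut is sound because the fixed point is consistent
(`kripkeJump_lfp_consistent`); the truth rules are sound because it is a fixed point. Arithmetical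
formulas are two-valued, so the original sequent fails in the structure and is not derivable in
`LPTN`.

The structure is not divided by its equality. This is harmless: identity replacement is restricted
to equations, so the interpretation of truth need not respect provable equality. -/

/-! ### Substitution and renaming -/

namespace Tm

/-- Renaming of the free variables of a term. -/
def ren (ρ : ℕ → ℕ) {n : ℕ} : Tm n → Tm n
  | fvar x => fvar (ρ x)
  | bvar i => bvar i
  | zero => zero
  | succ t => succ (t.ren ρ)
  | add s t => add (s.ren ρ) (t.ren ρ)
  | mul s t => mul (s.ren ρ) (t.ren ρ)

theorem subst_subst {n m k : ℕ} (σ : Fin n → Tm m) (τ : Fin m → Tm k) (t : Tm n) :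
    (t.subst σ).subst τ = t.subst fun i => (σ i).subst τ := by
  induction t <;> simp_all [subst]

theorem subst_bvar {n : ℕ} (t : Tm n) : t.subst bvar = t := by
  induction t <;> simp_all [subst]

theorem subst_zero {n : ℕ} (σ : Fin 0 → Tm n) (t : Tm 0) (τ : Fin n → Tm 0) :
    (t.subst σ).subst τ = t := by
  rw [subst_subst, show (fun i => (σ i).subst τ) = bvar from funext fun i => i.elim0, subst_bvar]

theorem shift_inst (t s : Tm 0) : t.shift.inst s = t := subst_zero _ _ _

theorem shift_subst {n m : ℕ} (σ : Fin n → Tm m) (t : Tm n) :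
    t.shift.subst (Fin.cases (bvar 0) fun i => (σ i).shift) = (t.subst σ).shift := by
  simp [shift, subst_subst, subst]

theorem ren_subst (ρ : ℕ → ℕ) {n m : ℕ} (σ : Fin n → Tm m) (t : Tm n) :
    (t.subst σ).ren ρ = (t.ren ρ).subst fun i => (σ i).ren ρ := by
  induction t <;> simp_all [subst, ren]

theorem ren_inst (ρ : ℕ → ℕ) (t : Tm 1) (s : Tm 0) :
    (t.inst s).ren ρ = (t.ren ρ).inst (s.ren ρ) := ren_subst _ _ _

theorem ren_id {n : ℕ} (t : Tm n) : t.ren id = t := by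
  induction t <;> simp_all [ren]

theorem ren_congr {ρ ρ' : ℕ → ℕ} {n : ℕ} {t : Tm n} (h : ∀ x ∈ t.fv, ρ x = ρ' x) :
    t.ren ρ = t.ren ρ' := by
  induction t <;> simp_all [ren, fv]

end Tm

namespace Fml

variable {U : Type}

/-- Renaming of the free variables of a formula. -/
def ren (ρ : ℕ → ℕ) : {n : ℕ} → Fml U n → Fml U n
  | _, eq s t => eq (s.ren ρ) (t.ren ρ)
  | _, pred u t => pred u (t.ren ρ)
  | _, neg φ => neg (ren ρ φ)
  | _, and φ ψ => and (ren ρ φ) (ren ρ ψ)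
  | _, all φ => all (ren ρ φ)

theorem subst_subst {n m k : ℕ} (σ : Fin n → Tm m) (τ : Fin m → Tm k) (φ : Fml U n) :
    (φ.subst σ).subst τ = φ.subst fun i => (σ i).subst τ := by
  induction φ generalizing m k with
  | eq | pred => simp [subst, Tm.subst_subst]
  | neg φ ih => simp [subst, ih]
  | and φ ψ ih ih' => simp [subst, ih, ih']
  | all φ ih =>
    simp only [subst, ih]
    congr 2
    funext i
    refine Fin.cases rfl (fun i => ?_) i
    exact Tm.shift_subst τ (σ i)

theorem subst_bvar {n : ℕ} (φ : Fml U n) : φ.subst Tm.bvar = φ := by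
  induction φ with
  | eq | pred => simp [subst, Tm.subst_bvar]
  | neg φ ih => simp [subst, ih]
  | and φ ψ ih ih' => simp [subst, ih, ih']
  | all φ ih =>
    simp only [subst]
    congr 1
    convert ih using 2
    funext i
    exact Fin.cases rfl (fun i => rfl) i

/-- This lets inductions over formulas with bound variables in scope pass a quantifier: opening the
binder only extends the assignment by `a`. -/
theorem subst_lift_inst {n : ℕ} (σ : Fin n → Tm 0) (φ : Fml U (n + 1)) (a : Tm 0) :
    (φ.subst (Fin.cases (Tm.bvar 0) fun i => (σ i).shift)).inst a =
      φ.subst (Fin.cases a σ) := by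
  rw [inst, subst_subst]
  congr 1
  funext i
  exact Fin.cases rfl (fun i => Tm.shift_inst _ _) i

theorem ren_subst (ρ : ℕ → ℕ) {n m : ℕ} (σ : Fin n → Tm m) (φ : Fml U n) :
    (φ.subst σ).ren ρ = (φ.ren ρ).subst fun i => (σ i).ren ρ := by
  induction φ generalizing m with
  | eq | pred => simp [subst, ren, Tm.ren_subst]
  | neg φ ih => simp [subst, ren, ih]
  | and φ ψ ih ih' => simp [subst, ren, ih, ih']
  | all φ ih =>
    simp only [subst, ren, ih]
    congr 2
    funext i
    refine Fin.cases rfl (fun i => ?_) i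
    exact Tm.ren_subst ρ _ (σ i)

theorem ren_inst (ρ : ℕ → ℕ) (φ : Fml U 1) (s : Tm 0) :
    (φ.inst s).ren ρ = (φ.ren ρ).inst (s.ren ρ) := ren_subst _ _ _

theorem ren_id {n : ℕ} (φ : Fml U n) : φ.ren id = φ := by
  induction φ <;> simp_all [ren, Tm.ren_id]

theorem ren_congr {ρ ρ' : ℕ → ℕ} {n : ℕ} {φ : Fml U n} (h : ∀ x ∈ φ.fv, ρ x = ρ' x) :
    φ.ren ρ = φ.ren ρ' := by
  induction φ with
  | eq s t =>
    simp only [fv, Finset.mem_union] at h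
    simp only [ren]
    rw [Tm.ren_congr fun x hx => h x (.inl hx), Tm.ren_congr fun x hx => h x (.inr hx)]
  | pred u t => simp only [ren, Tm.ren_congr h]
  | neg φ ih => simp only [ren, ih h]
  | and φ ψ ih ih' =>
    simp only [fv, Finset.mem_union] at h
    simp only [ren, ih fun x hx => h x (.inl hx), ih' fun x hx => h x (.inr hx)]
  | all φ ih => simp only [ren, ih h]

theorem ren_update {n : ℕ} {φ : Fml U n} {y : ℕ} (h : y ∉ φ.fv) (ρ : ℕ → ℕ) (z : ℕ) :
    φ.ren (Function.update ρ y z) = φ.ren ρ :=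
  ren_congr fun _ hx => Function.update_of_ne (by rintro rfl; exact h hx) _ _

end Fml

theorem NotFreeIn.map_ren_update {U : Type} {Γ : Multiset (Fml U 0)} {y : ℕ}
    (h : NotFreeIn y Γ) (ρ : ℕ → ℕ) (z : ℕ) :
    Γ.map (Fml.ren (Function.update ρ y z)) = Γ.map (Fml.ren ρ) :=
  Multiset.map_congr rfl fun φ hφ => Fml.ren_update (h φ hφ) ρ z

theorem exists_notFreeIn {U : Type} (Γ : Multiset (Fml U 0)) (s : Finset ℕ) :
    ∃ z, NotFreeIn z Γ ∧ z ∉ s := by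
  obtain ⟨z, hz⟩ := Infinite.exists_notMem_finset ((Γ.map Fml.fv).sup ∪ s)
  rw [Finset.mem_union, not_or] at hz
  exact ⟨z, fun φ hφ h => hz.1 (Finset.mem_of_subset (Multiset.le_sup (Multiset.mem_map_of_mem Fml.fv hφ)) h), hz.2⟩

theorem NotFreeIn.of_add_left {U : Type} {Γ Δ : Multiset (Fml U 0)} {y : ℕ}
    (h : NotFreeIn y (Γ + Δ)) : NotFreeIn y Γ :=
  fun φ hφ => h φ (Multiset.mem_add.2 (.inl hφ))

theorem NotFreeIn.of_add_right {U : Type} {Γ Δ : Multiset (Fml U 0)} {y : ℕ}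
    (h : NotFreeIn y (Γ + Δ)) : NotFreeIn y Δ :=
  fun φ hφ => h φ (Multiset.mem_add.2 (.inr hφ))

/-! ### Structural rules -/

open Fml in
-- Weakening can clash with an eigenvariable, which must then be renamed. Proving renaming and
-- weakening together, for all `ρ`, gives an induction hypothesis strong enough to do so.
theorem QG.ren_add {U : Type} {Γ Δ : Multiset (Fml U 0)} (h : QG Γ Δ) (ρ : ℕ → ℕ)
    (Γ' Δ' : Multiset (Fml U 0)) :
    QG (Γ.map (ren ρ) + Γ') (Δ.map (ren ρ) + Δ') := by
  unfold QG at *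
  induction h generalizing ρ with
  | ref s t => simpa [ren] using Derivable.ref _ _
  | cut φ _ _ ih ih' =>
    refine .cut (φ.ren ρ) ?_ ?_
    · simpa using ih ρ
    · simpa using ih' ρ
  | negL φ _ ih => simpa [ren] using Derivable.negL (φ.ren ρ) (by simpa using ih ρ)
  | negR φ _ ih => simpa [ren] using Derivable.negR (φ.ren ρ) (by simpa using ih ρ)
  | andL φ ψ _ ih =>
    simpa [ren] using Derivable.andL (φ.ren ρ) (ψ.ren ρ) (by simpa using ih ρ)
  | andR φ ψ _ _ ih ih' =>
    simpa [ren] using Derivable.andR (φ.ren ρ) (ψ.ren ρ) (by simpa using ih ρ)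
      (by simpa using ih' ρ)
  | allL φ s _ ih =>
    simpa [ren] using Derivable.allL (φ.ren ρ) (s.ren ρ) (by simpa [ren, ren_inst] using ih ρ)
  | @allR Γ Δ φ y hΓ hΔ hφ _ ih =>
    obtain ⟨z, hz, hz'⟩ := exists_notFreeIn
      ((Γ.map (ren ρ) + Γ') + (Δ.map (ren ρ) + Δ')) (φ.ren ρ).fv
    -- Sending the eigenvariable `y` to the fresh `z` leaves the renamed context unchanged, as `y`
    -- is not free in it.
    have := ih (Function.update ρ y z)
    rw [Multiset.map_cons, hΓ.map_ren_update, hΔ.map_ren_update, ren_inst,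
      ren_update (φ := φ) hφ, Tm.ren, Function.update_self, Multiset.cons_add] at this
    simpa [ren] using Derivable.allR (φ.ren ρ) z hz.of_add_left hz.of_add_right hz' this
  | eq1 t _ ih => exact .eq1 (t.ren ρ) (by simpa [ren] using ih ρ)
  | eq2 s t a b _ ih =>
    simpa [ren, Tm.ren_inst] using Derivable.eq2 (s.ren ρ) (t.ren ρ) (a.ren ρ) (b.ren ρ)
      (by simpa [ren, Tm.ren_inst] using ih ρ)
  | q1 x => simpa [ren, Tm.ren] using Derivable.q1 (ρ x)
  | q2 x y _ ih =>
    simpa [ren, Tm.ren] using Derivable.q2 (ρ x) (ρ y) (by simpa [ren, Tm.ren] using ih ρ)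
  | @q3 Γ Δ x y hΓ hΔ hxy _ _ ih ih' =>
    obtain ⟨z, hz, hz'⟩ := exists_notFreeIn
      ((Γ.map (ren ρ) + Γ') + (Δ.map (ren ρ) + Δ')) {ρ x}
    have := ih' (Function.update ρ y z)
    rw [Multiset.map_cons, hΓ.map_ren_update, hΔ.map_ren_update] at this
    refine .q3 (ρ x) z hz.of_add_left hz.of_add_right (by simpa using hz')
      (by simpa [ren, Tm.ren] using ih ρ) ?_
    simpa [ren, Tm.ren, hxy.symm] using this
  | q4 x _ ih => exact .q4 (ρ x) (by simpa [ren, Tm.ren] using ih ρ)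
  | q5 x y _ ih => exact .q5 (ρ x) (ρ y) (by simpa [ren, Tm.ren] using ih ρ)
  | q6 x _ ih => exact .q6 (ρ x) (by simpa [ren, Tm.ren] using ih ρ)
  | q7 x y _ ih => exact .q7 (ρ x) (ρ y) (by simpa [ren, Tm.ren] using ih ρ)
  | truthL _ _ h => exact h.elim
  | truthR _ _ h => exact h.elim

theorem QG.weaken {U : Type} {Γ Δ : Multiset (Fml U 0)} (h : QG Γ Δ)
    (Γ' Δ' : Multiset (Fml U 0)) : QG (Γ + Γ') (Δ + Δ') := by
  have hid : (Fml.ren id : Fml U 0 → Fml U 0) = id := funext Fml.ren_id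
  simpa [hid] using h.ren_add id Γ' Δ'

/-- Initial sequents are given for equations only. The induction runs over formulas with bound
variables in scope because `φ.inst s` is not a subformula of `φ.all`. -/
theorem QG.identity_subst {n : ℕ} (φ : ArithFml n) (σ : Fin n → Tm 0)
    (Γ Δ : Multiset (ArithFml 0)) : QG (φ.subst σ ::ₘ Γ) (φ.subst σ ::ₘ Δ) := by
  unfold QG at *
  induction φ generalizing Γ Δ with
  | eq s t => exact .ref _ _
  | pred u => exact u.elim
  | neg φ ih =>
    refine .negR _ ?_
    rw [Multiset.cons_swap]
    exact .negL _ (ih _ _ _)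
  | and φ ψ ih ih' =>
    refine .andL _ _ (.andR _ _ (ih _ _ _) ?_)
    rw [Multiset.cons_swap]
    exact ih' _ _ _
  | all φ ih =>
    set φ' := φ.subst (Fin.cases (Tm.bvar 0) fun i => (σ i).shift) with hφ'
    obtain ⟨z, hz, hz'⟩ := exists_notFreeIn ((φ'.all ::ₘ Γ) + Δ) φ'.all.fv
    refine Derivable.allR φ' z hz.of_add_left hz.of_add_right hz' (.allL φ' (.fvar z) ?_)
    rw [Multiset.cons_swap, hφ', Fml.subst_lift_inst]
    exact ih _ _ _

theorem QG.identity (φ : ArithFml 0) (Γ Δ : Multiset (ArithFml 0)) :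
    QG (φ ::ₘ Γ) (φ ::ₘ Δ) := by
  simpa [Fml.subst_bvar] using QG.identity_subst φ Tm.bvar Γ Δ

/-- Contraction is a cut against an identity sequent, hence stated for arithmetical formulas only.
-/
theorem QG.contractL {φ : ArithFml 0} {Γ Δ : Multiset (ArithFml 0)} (hφ : φ ∈ Γ)
    (h : QG (φ ::ₘ Γ) Δ) : QG Γ Δ := by
  obtain ⟨Γ', rfl⟩ := Multiset.exists_cons_of_mem hφ
  exact .cut φ (QG.identity φ Γ' Δ) h

theorem QG.contractR {φ : ArithFml 0} {Γ Δ : Multiset (ArithFml 0)} (hφ : φ ∈ Δ)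
    (h : QG Γ (φ ::ₘ Δ)) : QG Γ Δ := by
  obtain ⟨Δ', rfl⟩ := Multiset.exists_cons_of_mem hφ
  exact .cut φ h (QG.identity φ Γ Δ')

/-- Here `⊆` ignores multiplicities: weaken by the larger sides, then contract the original formulas
away one by one. -/
theorem QG.mono {Γ Δ Γ' Δ' : Multiset (ArithFml 0)} (h : QG Γ Δ) (hΓ : Γ ⊆ Γ') (hΔ : Δ ⊆ Δ') :
    QG Γ' Δ' := by
  have hL : QG Γ' (Δ + Δ') := by
    replace h := h.weaken Γ' Δ'
    induction Γ using Multiset.induction with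
    | empty => simpa using h
    | cons φ Γ ih =>
      rw [Multiset.cons_subset] at hΓ
      rw [Multiset.cons_add] at h
      exact ih hΓ.2 (h.contractL (Multiset.mem_add.2 (.inr hΓ.1)))
  clear h
  induction Δ using Multiset.induction with
  | empty => simpa using hL
  | cons φ Δ ih =>
    rw [Multiset.cons_subset] at hΔ
    rw [Multiset.cons_add] at hL
    exact ih hΔ.2 (hL.contractR (Multiset.mem_add.2 (.inr hΔ.1)))

/-! ### Countability of the language -/

/-- An injective numbering of terms. -/
def Tm.enc {n : ℕ} : Tm n → ℕ
  | fvar x => Nat.pair 0 x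
  | bvar i => Nat.pair 1 i
  | zero => Nat.pair 2 0
  | succ t => Nat.pair 3 t.enc
  | add s t => Nat.pair 4 (Nat.pair s.enc t.enc)
  | mul s t => Nat.pair 5 (Nat.pair s.enc t.enc)

theorem Tm.enc_injective {n : ℕ} : Function.Injective (Tm.enc (n := n)) := by
  intro s
  induction s with
  | fvar | bvar | zero => intro t h; cases t <;> simp_all [enc, Fin.ext_iff]
  | succ s ih =>
    intro t h
    cases t <;> simp only [enc, Nat.pair_eq_pair] at h <;> try omega
    rw [ih h.2]
  | add s s' ih ih' | mul s s' ih ih' =>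
    intro t h
    cases t <;> simp only [enc, Nat.pair_eq_pair] at h <;> try omega
    rw [ih h.2.1, ih' h.2.2]

/-- An injective numbering of arithmetical formulas. -/
def ArithFml.enc : {n : ℕ} → ArithFml n → ℕ
  | _, .eq s t => Nat.pair 0 (Nat.pair s.enc t.enc)
  | _, .pred u _ => u.elim
  | _, .neg φ => Nat.pair 1 (enc φ)
  | _, .and φ ψ => Nat.pair 2 (Nat.pair (enc φ) (enc ψ))
  | _, .all φ => Nat.pair 3 (enc φ)

theorem ArithFml.enc_injective {n : ℕ} : Function.Injective (ArithFml.enc (n := n)) := by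
  intro φ
  induction φ with
  | eq s t =>
    rintro (_ | ⟨⟨⟩, _⟩ | _ | _ | _) h <;> simp only [enc, Nat.pair_eq_pair] at h <;> try omega
    rw [Tm.enc_injective h.2.1, Tm.enc_injective h.2.2]
  | pred u => exact u.elim
  | neg φ ih | all φ ih =>
    rintro (_ | ⟨⟨⟩, _⟩ | _ | _ | _) h <;> simp only [enc, Nat.pair_eq_pair] at h <;> try omega
    rw [ih h.2]
  | and φ ψ ih ih' =>
    rintro (_ | ⟨⟨⟩, _⟩ | _ | _ | _) h <;> simp only [enc, Nat.pair_eq_pair] at h <;> try omega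
    rw [ih h.2.1, ih' h.2.2]

instance : Countable (ArithFml 0) := ArithFml.enc_injective.countable

/-! ### Henkin sets -/

/-- A set of arithmetical formulas that is the left part of a maximal underivable sequent with
witnesses for the universal formulas of its right part. -/
structure IsHenkin (L : Set (ArithFml 0)) : Prop where
  not_qg : ∀ Γ Δ : Multiset (ArithFml 0), (∀ φ ∈ Γ, φ ∈ L) → (∀ φ ∈ Δ, φ ∉ L) → ¬ QG Γ Δ
  witness : ∀ φ : ArithFml 1, φ.all ∉ L → ∃ t : Tm 0, φ.inst t ∉ L

/-- By cut, `φ` can join one side without making the sequent derivable. If a universal formula goes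
to the right, its instance at a fresh variable can go there too, by the right quantifier rule and
contraction. -/
theorem exists_henkin_step (φ : ArithFml 0) (Γ Δ : Multiset (ArithFml 0)) (h : ¬ QG Γ Δ) :
    ∃ Γ' Δ', Γ ⊆ Γ' ∧ Δ ⊆ Δ' ∧ ¬ QG Γ' Δ' ∧ (φ ∈ Γ' ∨ φ ∈ Δ') ∧
      (φ ∈ Γ' ∨ ∀ ψ : ArithFml 1, φ = ψ.all → ∃ t : Tm 0, ψ.inst t ∈ Δ') := by
  by_cases hL : QG (φ ::ₘ Γ) Δ
  · have hR : ¬ QG Γ (φ ::ₘ Δ) := fun hR => h (.cut φ hR hL)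
    by_cases hφ : ∃ ψ : ArithFml 1, φ = ψ.all
    · obtain ⟨ψ, rfl⟩ := hφ
      obtain ⟨z, hz, hz'⟩ := exists_notFreeIn (Γ + (ψ.all ::ₘ Δ)) ψ.all.fv
      refine ⟨Γ, ψ.inst (.fvar z) ::ₘ ψ.all ::ₘ Δ, fun _ h => h,
        fun _ h => by simp [h], fun h' => hR ?_, .inr (by simp), .inr ?_⟩
      · exact QG.contractR (Multiset.mem_cons_self _ _)
          (.allR ψ z hz.of_add_left hz.of_add_right hz' h')
      · rintro _ ⟨⟩
        exact ⟨.fvar z, by simp⟩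
    · exact ⟨Γ, φ ::ₘ Δ, fun _ h => h, Multiset.subset_cons _ _, hR, .inr (by simp),
        .inr fun ψ e => (hφ ⟨ψ, e⟩).elim⟩
  · exact ⟨φ ::ₘ Γ, Δ, Multiset.subset_cons _ _, fun _ h => h, hL, .inl (by simp),
      .inl (by simp)⟩

theorem exists_subset_of_mono {α : Type*} {S : ℕ → Multiset α}
    (hS : ∀ m n, m ≤ n → S m ⊆ S n) (Γ : Multiset α) (hΓ : ∀ φ ∈ Γ, ∃ n, φ ∈ S n) :
    ∃ n, Γ ⊆ S n := by
  induction Γ using Multiset.induction with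
  | empty => exact ⟨0, by simp⟩
  | cons φ Γ ih =>
    obtain ⟨n, hn⟩ := ih fun ψ hψ => hΓ ψ (Multiset.mem_cons_of_mem hψ)
    obtain ⟨m, hm⟩ := hΓ φ (Multiset.mem_cons_self _ _)
    exact ⟨max m n, Multiset.cons_subset.2 ⟨hS _ _ (le_max_left _ _) hm,
      fun _ h => hS _ _ (le_max_right _ _) (hn h)⟩⟩

theorem exists_isHenkin {Γ Δ : Multiset (ArithFml 0)} (h : ¬ QG Γ Δ) :
    ∃ L, IsHenkin L ∧ (∀ φ ∈ Γ, φ ∈ L) ∧ ∀ φ ∈ Δ, φ ∉ L := by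
  choose! G D hG hD hGD hmem hwit using exists_henkin_step
  have : Nonempty (ArithFml 0) := ⟨.eq .zero .zero⟩
  obtain ⟨e, he⟩ := exists_surjective_nat (ArithFml 0)
  let S : ℕ → Multiset (ArithFml 0) × Multiset (ArithFml 0) :=
    Nat.rec (Γ, Δ) fun n p => (G (e n) p.1 p.2, D (e n) p.1 p.2)
  have hS : ∀ n, ¬ QG (S n).1 (S n).2 := by
    intro n
    induction n with
    | zero => exact h
    | succ n ih => exact hGD _ _ _ ih
  have mono₁ : ∀ m n, m ≤ n → (S m).1 ⊆ (S n).1 := by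
    intro m n hmn
    induction hmn with
    | refl => exact fun _ h => h
    | step _ ih => exact fun _ h => hG _ _ _ (hS _) (ih h)
  have mono₂ : ∀ m n, m ≤ n → (S m).2 ⊆ (S n).2 := by
    intro m n hmn
    induction hmn with
    | refl => exact fun _ h => h
    | step _ ih => exact fun _ h => hD _ _ _ (hS _) (ih h)
  have disj : ∀ {φ m n}, φ ∈ (S m).1 → φ ∉ (S n).2 := by
    intro φ m n hm hn
    refine hS (max m n) ((QG.identity φ 0 0).mono ?_ ?_)
    · simpa using mono₁ _ _ (le_max_left m n) hm
    · simpa using mono₂ _ _ (le_max_right m n) hn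
  have total : ∀ {φ}, (¬ ∃ n, φ ∈ (S n).1) → ∃ n, φ ∈ (S n).2 := by
    intro φ hφ
    obtain ⟨n, rfl⟩ := he φ
    -- The formula `e n` is decided in passing from stage `n` to stage `n + 1`.
    exact ⟨n + 1, (hmem (e n) _ _ (hS n)).resolve_left fun h => hφ ⟨n + 1, h⟩⟩
  refine ⟨{φ | ∃ n, φ ∈ (S n).1}, ⟨?_, ?_⟩, fun φ hφ => ⟨0, hφ⟩, fun φ hφ ⟨n, hn⟩ =>
    disj (n := 0) hn hφ⟩
  · intro Γ' Δ' hΓ' hΔ' hd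
    obtain ⟨m, hm⟩ := exists_subset_of_mono mono₁ Γ' hΓ'
    obtain ⟨n, hn⟩ := exists_subset_of_mono mono₂ Δ' fun φ hφ => total (hΔ' φ hφ)
    exact hS (max m n) (hd.mono (fun _ h => mono₁ _ _ (le_max_left _ _) (hm h))
      (fun _ h => mono₂ _ _ (le_max_right _ _) (hn h)))
  · intro φ hφ
    obtain ⟨n, hn⟩ := he φ.all
    obtain ⟨t, ht⟩ := (hwit (e n) _ _ (hS n)).resolve_left
      (fun h => hφ ⟨n + 1, hn ▸ h⟩) φ hn
    exact ⟨t, fun ⟨m, hm⟩ => disj (n := n + 1) hm ht⟩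

namespace IsHenkin

open Fml

variable {L : Set (ArithFml 0)}

theorem neg_mem (hL : IsHenkin L) (φ : ArithFml 0) : neg φ ∈ L ↔ φ ∉ L := by
  constructor
  · intro h h'
    exact hL.not_qg {neg φ, φ} 0 (by simp [h, h']) (by simp)
      (.negL φ (QG.identity φ 0 0))
  · intro h
    by_contra h'
    exact hL.not_qg 0 {neg φ, φ} (by simp) (by simp [h, h'])
      (.negR φ (QG.identity φ 0 0))

theorem and_mem (hL : IsHenkin L) (φ ψ : ArithFml 0) : and φ ψ ∈ L ↔ φ ∈ L ∧ ψ ∈ L := by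
  constructor
  · intro h
    constructor <;> by_contra h'
    · exact hL.not_qg {and φ ψ} {φ} (by simp [h]) (by simp [h'])
        (.andL φ ψ (QG.identity φ _ 0))
    · refine hL.not_qg {and φ ψ} {ψ} (by simp [h]) (by simp [h']) (.andL φ ψ ?_)
      rw [Multiset.cons_swap]
      exact QG.identity ψ _ 0
  · rintro ⟨h, h'⟩
    by_contra h''
    refine hL.not_qg {φ, ψ} {and φ ψ} (by simp [h, h']) (by simp [h''])
      (.andR φ ψ (QG.identity φ _ 0) ?_)
    rw [Multiset.insert_eq_cons, ← Multiset.cons_zero ψ, Multiset.cons_swap]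
    exact QG.identity ψ _ 0

theorem all_mem (hL : IsHenkin L) (φ : ArithFml 1) : all φ ∈ L ↔ ∀ t, φ.inst t ∈ L := by
  constructor
  · intro h t
    by_contra h'
    refine hL.not_qg {all φ} {φ.inst t} (by simp [h]) (by simp [h']) (.allL φ t ?_)
    rw [Multiset.cons_swap]
    exact QG.identity (φ.inst t) _ 0
  · intro h
    by_contra h'
    obtain ⟨t, ht⟩ := hL.witness φ h'
    exact ht (h t)

theorem mem_of_qg (hL : IsHenkin L) {φ : ArithFml 0} (h : QG 0 {φ}) : φ ∈ L := by
  by_contra h'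
  exact hL.not_qg 0 {φ} (by simp) (by simp [h']) h

theorem eq_refl (hL : IsHenkin L) (t : Tm 0) : eq t t ∈ L :=
  hL.mem_of_qg (.eq1 t (.ref (Γ := 0) t t))

theorem eq_replace (hL : IsHenkin L) {s t : Tm 0} (a b : Tm 1)
    (h : eq s t ∈ L) (h' : eq (a.inst t) (b.inst t) ∈ L) : eq (a.inst s) (b.inst s) ∈ L := by
  by_contra h''
  refine hL.not_qg {eq s t, eq (a.inst t) (b.inst t)} {eq (a.inst s) (b.inst s)}
    (by simp [h, h']) (by simp [h'']) (.eq2 s t a b ?_)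
  rw [Multiset.cons_swap]
  exact .ref (Δ := 0) _ _

end IsHenkin

/-! ### Partial valuations over the term structure -/

namespace Tm

/-- The value of a term in the term structure, at `ρ` for the free and `e` for the bound
variables. -/
def eval (ρ : ℕ → Tm 0) {n : ℕ} (e : Fin n → Tm 0) : Tm n → Tm 0
  | fvar x => ρ x
  | bvar i => e i
  | zero => zero
  | succ t => succ (t.eval ρ e)
  | add s t => add (s.eval ρ e) (t.eval ρ e)
  | mul s t => mul (s.eval ρ e) (t.eval ρ e)

theorem eval_subst (ρ : ℕ → Tm 0) {n m : ℕ} (e : Fin m → Tm 0) (σ : Fin n → Tm m) (t : Tm n) :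
    (t.subst σ).eval ρ e = t.eval ρ fun i => (σ i).eval ρ e := by
  induction t <;> simp_all [subst, eval]

theorem eval_shift (ρ : ℕ → Tm 0) {n : ℕ} (e : Fin n → Tm 0) (a : Tm 0) (t : Tm n) :
    t.shift.eval ρ (Fin.cases a e) = t.eval ρ e := eval_subst _ _ _ _

theorem eval_fvar {n : ℕ} (e : Fin n → Tm 0) (t : Tm n) : t.eval fvar e = t.subst e := by
  induction t <;> simp_all [subst, eval]

theorem eval_congr {ρ ρ' : ℕ → Tm 0} {n : ℕ} (e : Fin n → Tm 0) {t : Tm n}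
    (h : ∀ x ∈ t.fv, ρ x = ρ' x) : t.eval ρ e = t.eval ρ' e := by
  induction t <;> simp_all [eval, fv]

theorem eval_numeral (ρ : ℕ → Tm 0) (e : Fin 0 → Tm 0) (k : ℕ) :
    (numeral k).eval ρ e = numeral k := by
  induction k <;> simp_all [eval, numeral]

theorem numeral_injective : Function.Injective numeral := by
  intro k
  induction k with
  | zero => rintro (_ | l) h <;> simp_all [numeral]
  | succ k ih =>
    rintro (_ | l) h
    · simp [numeral] at h
    · rw [ih (succ.inj h)]

end Tm

namespace Fml

variable {U : Type}

/-- Strong Kleene truth (`b = true`) and falsity (`b = false`) in the term structure, where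
equality is interpreted by `E`, and `X true` and `X false` are the extension and the
antiextension of the predicate symbols. -/
def Holds (E : Tm 0 → Tm 0 → Prop) (X : Bool → Set (Tm 0)) (ρ : ℕ → Tm 0) :
    {n : ℕ} → Bool → (Fin n → Tm 0) → Fml U n → Prop
  | _, true, e, eq s t => E (s.eval ρ e) (t.eval ρ e)
  | _, false, e, eq s t => ¬ E (s.eval ρ e) (t.eval ρ e)
  | _, b, e, pred _ t => t.eval ρ e ∈ X b
  | _, b, e, neg φ => Holds E X ρ (!b) e φ
  | _, true, e, and φ ψ => Holds E X ρ true e φ ∧ Holds E X ρ true e ψ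
  | _, false, e, and φ ψ => Holds E X ρ false e φ ∨ Holds E X ρ false e ψ
  | _, true, e, all φ => ∀ a : Tm 0, Holds E X ρ true (Fin.cases a e) φ
  | _, false, e, all φ => ∃ a : Tm 0, Holds E X ρ false (Fin.cases a e) φ

variable {E : Tm 0 → Tm 0 → Prop} {X : Bool → Set (Tm 0)}

theorem holds_subst (ρ : ℕ → Tm 0) {n m : ℕ} (b : Bool) (e : Fin m → Tm 0) (σ : Fin n → Tm m)
    (φ : Fml U n) :
    Holds E X ρ b e (φ.subst σ) ↔ Holds E X ρ b (fun i => (σ i).eval ρ e) φ := by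
  induction φ generalizing m b with
  | eq | pred => cases b <;> simp [subst, Holds, Tm.eval_subst]
  | neg φ ih => simp [subst, Holds, ih]
  | and φ ψ ih ih' => cases b <;> simp [subst, Holds, ih, ih']
  | all φ ih =>
    have key (a : Tm 0) : (fun i => Tm.eval ρ (Fin.cases a e)
        (Fin.cases (Tm.bvar 0) (fun i => (σ i).shift) i : Tm (m + 1))) =
        Fin.cases a fun i => (σ i).eval ρ e := by
      funext i
      exact Fin.cases rfl (fun i => Tm.eval_shift _ _ _ _) i
    cases b <;> simp only [subst, Holds, ih, key]

theorem holds_inst (ρ : ℕ → Tm 0) (b : Bool) (e : Fin 0 → Tm 0) (φ : Fml U 1) (s : Tm 0) :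
    Holds E X ρ b e (φ.inst s) ↔ Holds E X ρ b (Fin.cases (s.eval ρ e) e) φ := by
  rw [inst, holds_subst]
  have : (fun _ : Fin 1 => s.eval ρ e) = Fin.cases (s.eval ρ e) e := by
    funext i
    exact Fin.cases rfl (fun i => i.elim0) i
  rw [this]

theorem holds_congr {ρ ρ' : ℕ → Tm 0} {n : ℕ} {b : Bool} {e : Fin n → Tm 0} {φ : Fml U n}
    (h : ∀ x ∈ φ.fv, ρ x = ρ' x) : Holds E X ρ b e φ ↔ Holds E X ρ' b e φ := by
  induction φ generalizing b with
  | eq s t =>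
    simp only [fv, Finset.mem_union] at h
    cases b <;> simp only [Holds, Tm.eval_congr e fun x hx => h x (.inl hx),
      Tm.eval_congr e fun x hx => h x (.inr hx)]
  | pred u t => simp only [Holds, Tm.eval_congr e h]
  | neg φ ih => simp only [Holds, ih h]
  | and φ ψ ih ih' =>
    simp only [fv, Finset.mem_union] at h
    cases b <;> simp only [Holds, ih fun x hx => h x (.inl hx), ih' fun x hx => h x (.inr hx)]
  | all φ ih => cases b <;> simp only [Holds, ih h]

theorem holds_update {ρ : ℕ → Tm 0} {n : ℕ} {b : Bool} {e : Fin n → Tm 0} {φ : Fml U n} {y : ℕ}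
    (h : y ∉ φ.fv) (a : Tm 0) :
    Holds E X (Function.update ρ y a) b e φ ↔ Holds E X ρ b e φ :=
  holds_congr fun _ hx => Function.update_of_ne (by rintro rfl; exact h hx) _ _

/-- Negation switches between truth and falsity instead of complementing, so `X` occurs only
positively. -/
theorem Holds.mono {Y : Bool → Set (Tm 0)} (hXY : X ≤ Y) {ρ : ℕ → Tm 0} {n : ℕ} {b : Bool}
    {e : Fin n → Tm 0} {φ : Fml U n} (h : Holds E X ρ b e φ) : Holds E Y ρ b e φ := by
  induction φ generalizing b with
  | eq s t => cases b <;> exact h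
  | pred u t => simp only [Holds] at h ⊢; exact hXY b h
  | neg φ ih => simp only [Holds] at h ⊢; exact ih h
  | and φ ψ ih ih' =>
    cases b
    · exact Or.imp ih ih' h
    · exact And.imp ih ih' h
  | all φ ih =>
    cases b
    · exact Exists.imp (fun a => ih) h
    · exact fun a => ih (h a)

/-- De Morgan duality. The dual of `X` takes as extension what is outside the antiextension, and
conversely; `X` lies below its dual exactly when it is consistent. -/
theorem holds_dual (ρ : ℕ → Tm 0) {n : ℕ} (b : Bool) (e : Fin n → Tm 0) (φ : Fml U n) :
    Holds E (fun c => (X !c)ᶜ) ρ b e φ ↔ ¬ Holds E X ρ (!b) e φ := by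
  induction φ generalizing b with
  | eq s t => cases b <;> simp [Holds]
  | pred u t => simp [Holds]
  | neg φ ih => simp [Holds, ih]
  | and φ ψ ih ih' => cases b <;> simp [Holds, ih, ih', imp_iff_not_or]
  | all φ ih => cases b <;> simp [Holds, ih]

theorem Holds.not_of_consistent (hX : X ≤ fun c => (X !c)ᶜ) {ρ : ℕ → Tm 0} {n : ℕ} {b : Bool}
    {e : Fin n → Tm 0} {φ : Fml U n} (h : Holds E X ρ b e φ) : ¬ Holds E X ρ (!b) e φ :=
  (holds_dual ρ b e φ).1 (h.mono hX)

end Fml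

theorem ArithFml.holds_toTruth {E : Tm 0 → Tm 0 → Prop} {X : Bool → Set (Tm 0)} (ρ : ℕ → Tm 0)
    {n : ℕ} (b : Bool) (e : Fin n → Tm 0) (φ : ArithFml n) :
    Fml.Holds E X ρ b e φ.toTruth ↔ φ.Holds E X ρ b e := by
  induction φ generalizing b with
  | eq s t => cases b <;> rfl
  | pred u => exact u.elim
  | neg φ ih => simp only [toTruth, Fml.Holds, ih]
  | and φ ψ ih ih' => cases b <;> simp only [toTruth, Fml.Holds, ih, ih']
  | all φ ih => cases b <;> simp only [toTruth, Fml.Holds, ih]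

theorem ArithFml.holds_not {E : Tm 0 → Tm 0 → Prop} {X : Bool → Set (Tm 0)} (ρ : ℕ → Tm 0)
    {n : ℕ} (b : Bool) (e : Fin n → Tm 0) (φ : ArithFml n) :
    φ.Holds E X ρ (!b) e ↔ ¬ φ.Holds E X ρ b e := by
  induction φ generalizing b with
  | eq s t => cases b <;> simp [Fml.Holds]
  | pred u => exact u.elim
  | neg φ ih => simp [Fml.Holds, ih]
  | and φ ψ ih ih' =>
    have h := ih true
    have h' := ih' true
    simp only [Bool.not_true] at h h'
    cases b <;> simp [Fml.Holds, h, h', imp_iff_not_or]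
  | all φ ih =>
    have h e := ih true e
    simp only [Bool.not_true] at h
    cases b <;> simp [Fml.Holds, h]

/-! ### The Kripke fixed point -/

/-- The operator that sends a partial interpretation `X` of the truth predicate to the codes of
the sentences that are true, respectively false, under `X`. -/
def kripkeJump (code : TruthFml 0 → ℕ) (E : Tm 0 → Tm 0 → Prop) :
    (Bool → Set (Tm 0)) →o (Bool → Set (Tm 0)) where
  toFun X b := {t | ∃ φ : TruthFml 0, φ.IsSentence ∧ t = Tm.numeral (code φ) ∧
    φ.Holds E X Tm.fvar b Fin.elim0}
  monotone' _ _ h _ := fun _ ⟨φ, hφ, ht, hh⟩ => ⟨φ, hφ, ht, hh.mono h⟩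

/-- The dual of the least fixed point is closed under the jump, hence lies above it. Injectivity of
`code` ensures that one numeral does not name two sentences with conflicting values. -/
theorem kripkeJump_lfp_consistent {code : TruthFml 0 → ℕ}
    (hcode : Set.InjOn code {φ | φ.IsSentence}) (E : Tm 0 → Tm 0 → Prop) :
    (kripkeJump code E).lfp ≤ fun c => ((kripkeJump code E).lfp !c)ᶜ := by
  refine OrderHom.lfp_le _ ?_
  rintro b _ ⟨φ, hφ, rfl, hh⟩ hmem
  rw [Fml.holds_dual] at hh
  rw [← OrderHom.map_lfp] at hmem
  obtain ⟨ψ, hψ, he, hh'⟩ := hmem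
  exact hh (hcode hφ hψ (Tm.numeral_injective he) ▸ hh')

/-! ### Soundness -/

/-- The atomic conditions under which the term structure with equality `E` satisfies the axioms
of identity and of Robinson arithmetic. -/
structure IsRobinson (E : Tm 0 → Tm 0 → Prop) : Prop where
  refl : ∀ t, E t t
  replace : ∀ {s t} (ρ : ℕ → Tm 0) (a b : Tm 1), E s t →
    E (a.eval ρ fun _ => t) (b.eval ρ fun _ => t) → E (a.eval ρ fun _ => s) (b.eval ρ fun _ => s)
  succ_ne_zero : ∀ t, ¬ E (.succ t) .zero
  succ_inj : ∀ s t, E (.succ s) (.succ t) → E s t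
  zero_or_succ : ∀ t, E t .zero ∨ ∃ u, E t (.succ u)
  add_zero : ∀ t, E (.add t .zero) t
  add_succ : ∀ s t, E (.add s (.succ t)) (.succ (.add s t))
  mul_zero : ∀ t, E (.mul t .zero) .zero
  mul_succ : ∀ s t, E (.mul s (.succ t)) (.add (.mul s t) s)

/-- Some formula of `Γ` is false or some formula of `Δ` is true. -/
def SequentHolds {U : Type} (E : Tm 0 → Tm 0 → Prop) (X : Bool → Set (Tm 0)) (ρ : ℕ → Tm 0)
    (Γ Δ : Multiset (Fml U 0)) : Prop :=
  (∃ φ ∈ Γ, φ.Holds E X ρ false Fin.elim0) ∨ ∃ φ ∈ Δ, φ.Holds E X ρ true Fin.elim0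

section

variable {U : Type} {E : Tm 0 → Tm 0 → Prop} {X : Bool → Set (Tm 0)} {ρ : ℕ → Tm 0}
  {φ : Fml U 0} {Γ Δ : Multiset (Fml U 0)}

theorem sequentHolds_cons_left : SequentHolds E X ρ (φ ::ₘ Γ) Δ ↔
    φ.Holds E X ρ false Fin.elim0 ∨ SequentHolds E X ρ Γ Δ := by
  simp [SequentHolds, or_assoc]

theorem sequentHolds_cons_right : SequentHolds E X ρ Γ (φ ::ₘ Δ) ↔
    φ.Holds E X ρ true Fin.elim0 ∨ SequentHolds E X ρ Γ Δ := by
  simp [SequentHolds, or_left_comm]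

theorem sequentHolds_update {y : ℕ} (hΓ : NotFreeIn y Γ) (hΔ : NotFreeIn y Δ) (a : Tm 0) :
    SequentHolds E X (Function.update ρ y a) Γ Δ ↔ SequentHolds E X ρ Γ Δ := by
  unfold SequentHolds
  refine or_congr (exists_congr fun φ => and_congr_right fun h => ?_)
    (exists_congr fun φ => and_congr_right fun h => ?_)
  · exact Fml.holds_update (hΓ φ h) a
  · exact Fml.holds_update (hΔ φ h) a

end

/-- Consistency `hX` serves only the cut rule. The truth rules need only that values pass from the
named sentence to its ascription. -/
theorem Derivable.sequentHolds {U : Type} {Names : Fml U 0 → Fml U 0 → Prop}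
    {E : Tm 0 → Tm 0 → Prop} (hE : IsRobinson E) {X : Bool → Set (Tm 0)}
    (hX : X ≤ fun c => (X !c)ᶜ)
    (hN : ∀ φ ψ, Names φ ψ → ∀ b ρ, φ.Holds E X ρ b Fin.elim0 → ψ.Holds E X ρ b Fin.elim0)
    {Γ Δ : Multiset (Fml U 0)} (h : Derivable Names Γ Δ) (ρ : ℕ → Tm 0) :
    SequentHolds E X ρ Γ Δ := by
  induction h generalizing ρ with
  | ref s t =>
    simp only [sequentHolds_cons_left, sequentHolds_cons_right, Fml.Holds]
    tauto
  | cut φ _ _ ih ih' =>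
    have h := ih ρ
    have h' := ih' ρ
    rw [sequentHolds_cons_right] at h
    rw [sequentHolds_cons_left] at h'
    rcases h with h | h
    · exact h'.resolve_left (h.not_of_consistent hX)
    · exact h
  | negL φ _ ih | negR φ _ ih =>
    have h := ih ρ
    simpa only [sequentHolds_cons_left, sequentHolds_cons_right, Fml.Holds, Bool.not_true,
      Bool.not_false] using h
  | andL φ ψ _ ih =>
    have h := ih ρ
    simp only [sequentHolds_cons_left, Fml.Holds] at h ⊢
    tauto
  | andR φ ψ _ _ ih ih' =>
    have h := ih ρ
    have h' := ih' ρ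
    simp only [sequentHolds_cons_right, Fml.Holds] at h h' ⊢
    tauto
  | allL φ s _ ih =>
    have h := ih ρ
    simp only [sequentHolds_cons_left, Fml.Holds, Fml.holds_inst] at h ⊢
    rcases h with h | h | h
    · exact .inl h
    · exact .inl ⟨_, h⟩
    · exact .inr h
  | allR φ y hΓ hΔ hφ _ ih =>
    rw [sequentHolds_cons_right]
    by_contra! hc
    refine hc.1 fun a => ?_
    have h := ih (Function.update ρ y a)
    rw [sequentHolds_cons_right, sequentHolds_update hΓ hΔ, Fml.holds_inst,
      Fml.holds_update (φ := φ) hφ, Tm.eval, Function.update_self] at h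
    exact h.resolve_right hc.2
  | eq1 t _ ih =>
    have h := ih ρ
    simp only [sequentHolds_cons_left, Fml.Holds] at h
    exact h.resolve_left (not_not.2 (hE.refl _))
  | eq2 s t a b _ ih =>
    have h := ih ρ
    simp only [sequentHolds_cons_left, Fml.Holds, Tm.inst, Tm.eval_subst] at h ⊢
    have := hE.replace (s := s.eval ρ Fin.elim0) (t := t.eval ρ Fin.elim0) ρ a b
    tauto
  | q1 x =>
    rw [sequentHolds_cons_left]
    exact .inl (hE.succ_ne_zero _)
  | q2 x y _ ih =>
    have h := ih ρ
    simp only [sequentHolds_cons_left, Fml.Holds, Tm.eval] at h ⊢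
    have := hE.succ_inj (ρ x) (ρ y)
    tauto
  | q3 x y hΓ hΔ hxy _ _ ih ih' =>
    rcases hE.zero_or_succ (ρ x) with h0 | ⟨u, hu⟩
    · have h := ih ρ
      rw [sequentHolds_cons_left] at h
      exact h.resolve_left (not_not.2 h0)
    · have h := ih' (Function.update ρ y u)
      rw [sequentHolds_cons_left, sequentHolds_update hΓ hΔ] at h
      refine h.resolve_left (not_not.2 ?_)
      simpa [Tm.eval, hxy.symm] using hu
  | q4 x _ ih =>
    have h := ih ρ
    rw [sequentHolds_cons_left] at h
    exact h.resolve_left (not_not.2 (hE.add_zero _))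
  | q5 x y _ ih =>
    have h := ih ρ
    rw [sequentHolds_cons_left] at h
    exact h.resolve_left (not_not.2 (hE.add_succ _ _))
  | q6 x _ ih =>
    have h := ih ρ
    rw [sequentHolds_cons_left] at h
    exact h.resolve_left (not_not.2 (hE.mul_zero _))
  | q7 x y _ ih =>
    have h := ih ρ
    rw [sequentHolds_cons_left] at h
    exact h.resolve_left (not_not.2 (hE.mul_succ _ _))
  | truthL φ ψ hφψ _ ih =>
    have h := ih ρ
    rw [sequentHolds_cons_left] at h ⊢
    exact h.imp_left (hN φ ψ hφψ _ ρ)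
  | truthR φ ψ hφψ _ ih =>
    have h := ih ρ
    rw [sequentHolds_cons_right] at h ⊢
    exact h.imp_left (hN φ ψ hφψ _ ρ)

theorem LPTN.sequentHolds {code : TruthFml 0 → ℕ}
    (hcode : Set.InjOn code {φ | φ.IsSentence}) {E : Tm 0 → Tm 0 → Prop} (hE : IsRobinson E)
    {Γ Δ : Multiset (TruthFml 0)} (h : LPTN code Γ Δ) (ρ : ℕ → Tm 0) :
    SequentHolds E (kripkeJump code E).lfp ρ Γ Δ := by
  refine Derivable.sequentHolds hE (kripkeJump_lfp_consistent hcode E) ?_ h ρ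
  rintro φ _ ⟨hφ, rfl⟩ b ρ hh
  simp only [Fml.Holds, Tm.eval_numeral]
  rw [← OrderHom.map_lfp]
  -- The jump evaluates sentences at the fixed assignment `Tm.fvar`; having no free variables, `φ`
  -- has the same value at `ρ`.
  refine ⟨φ, hφ, rfl, (Fml.holds_congr fun x hx => ?_).1 hh⟩
  rw [hφ] at hx
  simp at hx

/-! ### The term structure of a Henkin set -/

namespace IsHenkin

open Fml Tm

variable {L : Set (ArithFml 0)}

/-- The truth lemma: every element of the structure is a term, so an assignment to bound variables
is also a substitution. -/
theorem holds_iff_mem (hL : IsHenkin L) (X : Bool → Set (Tm 0)) {n : ℕ} (e : Fin n → Tm 0)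
    (φ : ArithFml n) :
    φ.Holds (fun s t => eq s t ∈ L) X fvar true e ↔ φ.subst e ∈ L := by
  induction φ with
  | eq s t => simp only [Holds, eval_fvar, Fml.subst]
  | pred u => exact u.elim
  | neg φ ih =>
    simp only [Holds, Fml.subst, hL.neg_mem, ← ih]
    exact ArithFml.holds_not _ true _ _
  | and φ ψ ih ih' => simp only [Holds, Fml.subst, hL.and_mem, ih, ih']
  | all φ ih => simp only [Holds, Fml.subst, hL.all_mem, ih, subst_lift_inst]

theorem holds_iff_mem_zero (hL : IsHenkin L) (X : Bool → Set (Tm 0)) (φ : ArithFml 0) :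
    φ.Holds (fun s t => eq s t ∈ L) X fvar true Fin.elim0 ↔ φ ∈ L := by
  rw [hL.holds_iff_mem, show (Fin.elim0 : Fin 0 → Tm 0) = bvar from funext fun i => i.elim0,
    Fml.subst_bvar]

theorem eq_symm (hL : IsHenkin L) {s t : Tm 0} (h : eq s t ∈ L) : eq t s ∈ L := by
  -- Replacement in `t = v` turns `t = t` into `t = s`.
  have := hL.eq_replace (shift t) (bvar 0) h
  simp only [shift_inst] at this
  exact this (hL.eq_refl t)

theorem eq_trans (hL : IsHenkin L) {s t u : Tm 0} (h : eq s t ∈ L) (h' : eq t u ∈ L) :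
    eq s u ∈ L := by
  have := hL.eq_replace (bvar 0) (shift u) h
  simp only [shift_inst] at this
  exact this h'

theorem eq_subst (hL : IsHenkin L) {s t : Tm 0} (h : eq s t ∈ L) (a : Tm 1) :
    eq (a.inst s) (a.inst t) ∈ L := by
  have := hL.eq_replace a (shift (a.inst t)) h
  simp only [shift_inst] at this
  exact this (hL.eq_refl _)

/-- Evaluation also replaces the free variables of `a`, so this is not directly an instance of
`eq_subst`. -/
theorem eq_eval (hL : IsHenkin L) {s t : Tm 0} (h : eq s t ∈ L) (ρ : ℕ → Tm 0) (a : Tm 1) :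
    eq (a.eval ρ fun _ => s) (a.eval ρ fun _ => t) ∈ L := by
  have add_congr {s s' t t' : Tm 0} (h : eq s s' ∈ L) (h' : eq t t' ∈ L) :
      eq (add s t) (add s' t') ∈ L := by
    have h₁ := hL.eq_subst h (add (bvar 0) (shift t))
    have h₂ := hL.eq_subst h' (add (shift s') (bvar 0))
    simp only [Tm.inst, Tm.subst, shift, subst_zero] at h₁ h₂
    exact hL.eq_trans h₁ h₂
  have mul_congr {s s' t t' : Tm 0} (h : eq s s' ∈ L) (h' : eq t t' ∈ L) :
      eq (mul s t) (mul s' t') ∈ L := by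
    have h₁ := hL.eq_subst h (mul (bvar 0) (shift t))
    have h₂ := hL.eq_subst h' (mul (shift s') (bvar 0))
    simp only [Tm.inst, Tm.subst, shift, subst_zero] at h₁ h₂
    exact hL.eq_trans h₁ h₂
  induction a with
  | fvar x => exact hL.eq_refl _
  | bvar i => exact h
  | zero => exact hL.eq_refl _
  | succ a ih => exact hL.eq_subst ih (succ (bvar 0))
  | add a b ih ih' => exact add_congr ih ih'
  | mul a b ih ih' => exact mul_congr ih ih'

theorem holds_of_qg (hL : IsHenkin L) {φ : ArithFml 0} (h : QG 0 {φ}) :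
    φ.Holds (fun s t => eq s t ∈ L) (fun _ => ∅) fvar true Fin.elim0 :=
  (hL.holds_iff_mem_zero _ _).2 (hL.mem_of_qg h)

end IsHenkin

/-! ### Universal closures of the Robinson axioms -/

theorem notFreeIn_zero {U : Type} (x : ℕ) : NotFreeIn x (0 : Multiset (Fml U 0)) := by
  simp [NotFreeIn]

namespace QG

open Fml Tm

theorem all_intro {φ : ArithFml 1} (h : φ.fv = ∅) (h' : QG 0 {φ.inst (fvar 0)}) :
    QG 0 {all φ} :=
  .allR φ 0 (notFreeIn_zero 0) (notFreeIn_zero 0) (by simp [Fml.fv, h]) h'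

theorem all_all_intro {φ : ArithFml 2} (h : φ.fv = ∅) (h₁ : 1 ∉ (φ.all.inst (fvar 0)).fv)
    (h' : QG 0 {φ.subst (Fin.cases (fvar 1) fun _ => fvar 0)}) : QG 0 {all (all φ)} := by
  refine all_intro h (.allR (Δ := 0) _ 1 (notFreeIn_zero 1) (notFreeIn_zero 1) h₁ ?_)
  rw [subst_lift_inst]
  exact h'

theorem succ_ne_zero : QG 0 {all (neg (eq (succ (bvar 0)) zero) : ArithFml 1)} :=
  all_intro rfl (.negR (Δ := 0) _ (.q1 0))

theorem add_zero : QG 0 {all (eq (add (bvar 0) zero) (bvar 0) : ArithFml 1)} :=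
  all_intro rfl (.q4 0 (.ref _ _))

theorem mul_zero : QG 0 {all (eq (mul (bvar 0) zero) zero : ArithFml 1)} :=
  all_intro rfl (.q6 0 (.ref _ _))

theorem add_succ : QG 0 {all (all (eq (add (bvar 1) (succ (bvar 0)))
    (succ (add (bvar 1) (bvar 0)))) : ArithFml 1)} :=
  all_all_intro rfl (by decide) (.q5 0 1 (.ref _ _))

theorem mul_succ : QG 0 {all (all (eq (mul (bvar 1) (succ (bvar 0)))
    (add (mul (bvar 1) (bvar 0)) (bvar 1))) : ArithFml 1)} :=
  all_all_intro rfl (by decide) (.q7 0 1 (.ref _ _))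

theorem succ_inj : QG 0 {all (all (neg (and (eq (succ (bvar 1)) (succ (bvar 0)))
    (neg (eq (bvar 1) (bvar 0))))) : ArithFml 1)} := by
  refine all_all_intro rfl (by decide) (.negR (Δ := 0) _ (.andL _ _ ?_))
  rw [Multiset.cons_swap]
  exact .negL _ (.q2 0 1 (.ref _ _))

theorem zero_or_succ : QG 0 {all (neg (and (neg (eq (bvar 0) zero))
    (all (neg (eq (bvar 1) (succ (bvar 0)))))) : ArithFml 1)} := by
  refine all_intro rfl (.negR (Δ := 0) _ (.andL _ _ (.negL _ ?_)))
  refine .q3 0 1 ?_ ?_ one_ne_zero (.ref _ _) ?_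
  · intro φ hφ
    obtain rfl := Multiset.mem_singleton.1 hφ
    decide
  · intro φ hφ
    obtain rfl := Multiset.mem_singleton.1 hφ
    decide
  · rw [Multiset.cons_swap]
    refine .allL _ (fvar 1) ?_
    rw [Multiset.cons_swap]
    refine .negL _ ?_
    rw [Multiset.cons_swap]
    exact .ref _ _

end QG

/-- The arithmetical rules speak of variables only. Their derived universal closures are true in the
structure, which gives them for all terms. -/
theorem IsHenkin.isRobinson {L : Set (ArithFml 0)} (hL : IsHenkin L) :
    IsRobinson fun s t => Fml.eq s t ∈ L where
  refl := hL.eq_refl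
  -- The chain is `a(s) = a(t) = b(t) = b(s)`.
  replace ρ a b h h' :=
    hL.eq_trans (hL.eq_eval h ρ a) (hL.eq_trans h' (hL.eq_symm (hL.eq_eval h ρ b)))
  succ_ne_zero := hL.holds_of_qg QG.succ_ne_zero
  succ_inj s t h := by
    have := hL.holds_of_qg QG.succ_inj s t
    simp only [Fml.Holds, Bool.not_true, Bool.not_false] at this
    exact this.resolve_left (not_not.2 h)
  zero_or_succ t := by
    have := hL.holds_of_qg QG.zero_or_succ t
    simp only [Fml.Holds, Bool.not_true, Bool.not_false] at this
    exact this
  add_zero := hL.holds_of_qg QG.add_zero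
  add_succ := hL.holds_of_qg QG.add_succ
  mul_zero := hL.holds_of_qg QG.mul_zero
  mul_succ := hL.holds_of_qg QG.mul_succ

/-! ### Conservativity -/

theorem LPTN.qg {code : TruthFml 0 → ℕ} (hcode : Set.InjOn code {φ | φ.IsSentence})
    {Γ Δ : Multiset (ArithFml 0)}
    (h : LPTN code (Γ.map ArithFml.toTruth) (Δ.map ArithFml.toTruth)) : QG Γ Δ := by
  by_contra hc
  obtain ⟨L, hL, hΓ, hΔ⟩ := exists_isHenkin hc
  rcases h.sequentHolds hcode hL.isRobinson Tm.fvar with ⟨_, hφ, hh⟩ | ⟨_, hφ, hh⟩ <;>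
    obtain ⟨φ, hmem, rfl⟩ := Multiset.mem_map.1 hφ <;> rw [ArithFml.holds_toTruth] at hh
  · exact (ArithFml.holds_not _ true _ _).1 hh ((hL.holds_iff_mem_zero _ _).2 (hΓ φ hmem))
  · exact hΔ φ hmem ((hL.holds_iff_mem_zero _ _).1 hh)

/-! ### Embedding of derivations into the richer calculus and language -/

theorem QG.derivable {U : Type} (Names : Fml U 0 → Fml U 0 → Prop) {Γ Δ : Multiset (Fml U 0)}
    (h : QG Γ Δ) : Derivable Names Γ Δ := by
  unfold QG at h
  induction h with
  | ref s t => exact .ref s t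
  | cut φ _ _ ih ih' => exact .cut φ ih ih'
  | negL φ _ ih => exact .negL φ ih
  | negR φ _ ih => exact .negR φ ih
  | andL φ ψ _ ih => exact .andL φ ψ ih
  | andR φ ψ _ _ ih ih' => exact .andR φ ψ ih ih'
  | allL φ s _ ih => exact .allL φ s ih
  | allR φ y hΓ hΔ hφ _ ih => exact .allR φ y hΓ hΔ hφ ih
  | eq1 t _ ih => exact .eq1 t ih
  | eq2 s t a b _ ih => exact .eq2 s t a b ih
  | q1 x => exact .q1 x
  | q2 x y _ ih => exact .q2 x y ih
  | q3 x y hΓ hΔ hxy _ _ ih ih' => exact .q3 x y hΓ hΔ hxy ih ih'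
  | q4 x _ ih => exact .q4 x ih
  | q5 x y _ ih => exact .q5 x y ih
  | q6 x _ ih => exact .q6 x ih
  | q7 x y _ ih => exact .q7 x y ih
  | truthL _ _ h => exact h.elim
  | truthR _ _ h => exact h.elim

namespace ArithFml

theorem toTruth_subst {n m : ℕ} (σ : Fin n → Tm m) (φ : ArithFml n) :
    toTruth (φ.subst σ) = φ.toTruth.subst σ := by
  induction φ generalizing m with
  | eq => rfl
  | pred u => exact u.elim
  | neg φ ih => simp only [Fml.subst, toTruth, ih]
  | and φ ψ ih ih' => simp only [Fml.subst, toTruth, ih, ih']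
  | all φ ih => simp only [Fml.subst, toTruth, ih]

theorem toTruth_inst (φ : ArithFml 1) (s : Tm 0) : toTruth (φ.inst s) = φ.toTruth.inst s :=
  toTruth_subst _ _

theorem fv_toTruth {n : ℕ} (φ : ArithFml n) : φ.toTruth.fv = φ.fv := by
  induction φ with
  | eq => rfl
  | pred u => exact u.elim
  | neg φ ih => simp only [Fml.fv, toTruth, ih]
  | and φ ψ ih ih' => simp only [Fml.fv, toTruth, ih, ih']
  | all φ ih => simp only [Fml.fv, toTruth, ih]

end ArithFml

theorem NotFreeIn.map_toTruth {x : ℕ} {Γ : Multiset (ArithFml 0)} (h : NotFreeIn x Γ) :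
    NotFreeIn x (Γ.map ArithFml.toTruth) := by
  intro _ hφ
  obtain ⟨φ, hmem, rfl⟩ := Multiset.mem_map.1 hφ
  rw [ArithFml.fv_toTruth]
  exact h φ hmem

open ArithFml in
theorem QG.map_toTruth {Γ Δ : Multiset (ArithFml 0)} (h : QG Γ Δ) :
    QG (Γ.map toTruth) (Δ.map toTruth) := by
  unfold QG at *
  induction h with
  | ref s t => simpa [toTruth] using Derivable.ref s t
  | cut φ _ _ ih ih' => exact .cut (toTruth φ) (by simpa using ih) (by simpa using ih')
  | negL φ _ ih => simpa [toTruth] using Derivable.negL (toTruth φ) (by simpa using ih)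
  | negR φ _ ih => simpa [toTruth] using Derivable.negR (toTruth φ) (by simpa using ih)
  | andL φ ψ _ ih =>
    simpa [toTruth] using Derivable.andL (toTruth φ) (toTruth ψ) (by simpa using ih)
  | andR φ ψ _ _ ih ih' =>
    simpa [toTruth] using Derivable.andR (toTruth φ) (toTruth ψ) (by simpa using ih)
      (by simpa using ih')
  | allL φ s _ ih =>
    simpa [toTruth] using Derivable.allL (toTruth φ) s (by simpa [toTruth, toTruth_inst] using ih)
  | allR φ y hΓ hΔ hφ _ ih =>
    simpa [toTruth] using Derivable.allR (toTruth φ) y hΓ.map_toTruth hΔ.map_toTruth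
      (by simpa [Fml.fv, fv_toTruth] using hφ) (by simpa [toTruth_inst] using ih)
  | eq1 t _ ih => exact .eq1 t (by simpa [toTruth] using ih)
  | eq2 s t a b _ ih =>
    simpa [toTruth] using Derivable.eq2 s t a b (by simpa [toTruth] using ih)
  | q1 x => simpa [toTruth] using Derivable.q1 x
  | q2 x y _ ih => simpa [toTruth] using Derivable.q2 x y (by simpa [toTruth] using ih)
  | q3 x y hΓ hΔ hxy _ _ ih ih' =>
    exact .q3 x y hΓ.map_toTruth hΔ.map_toTruth hxy (by simpa [toTruth] using ih)
      (by simpa [toTruth] using ih')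
  | q4 x _ ih => exact .q4 x (by simpa [toTruth] using ih)
  | q5 x y _ ih => exact .q5 x y (by simpa [toTruth] using ih)
  | q6 x _ ih => exact .q6 x (by simpa [toTruth] using ih)
  | q7 x y _ ih => exact .q7 x y (by simpa [toTruth] using ih)
  | truthL _ _ h => exact h.elim
  | truthR _ _ h => exact h.elim

theorem mainTheorem3 (code : TruthFml 0 → ℕ)
    (hcode : Set.InjOn code {φ | φ.IsSentence}) :
    (∀ Γ Δ : Multiset (TruthFml 0), QG Γ Δ → LPTN code Γ Δ) ∧
    (∀ Γ Δ : Multiset (ArithFml 0),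
      (LPTN code (Γ.map ArithFml.toTruth) (Δ.map ArithFml.toTruth) ↔
        QG (Γ.map ArithFml.toTruth) (Δ.map ArithFml.toTruth)) ∧
      (LPTN code (Γ.map ArithFml.toTruth) (Δ.map ArithFml.toTruth) ↔ QG Γ Δ)) :=
  ⟨fun _ _ h => h.derivable _, fun _ _ =>
    -- Truth rules are eliminated by passing through a derivation in purely arithmetical formulas.
    ⟨⟨fun h => (h.qg hcode).map_toTruth, fun h => h.derivable _⟩,
      ⟨fun h => h.qg hcode, fun h => h.map_toTruth.derivable _⟩⟩⟩
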